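/- Let $\mathbb S^d=\{x\in\mathbb R^{d+1}:\|x\|_2=1\}$ with its normalized surface measure $\pi_d$, for $d\in\mathbb N=\{1,2,\dots\}$. For $x\in\mathbb S^d$ and $t\in[-1,1]$ let $C(x,t)=\{y\in\mathbb S^d:\langle x,y\rangle>t\}$, and let $\mathcal S_d=\{C(x,t)\cap C(y,s): x,y\in\mathbb S^d,\ s,t\in[-1,1]\}$ be the family of spherical slices. The dispersion of a finite set $\mathcal P\subseteq\mathbb S^d$ is $$\operatorname{disp}(\mathcal P;d)=\sup\{\pi_d(B): B\in\mathcal S_d,\ \mathcal P\cap B=\emptyset\}.$$ For $n\in\mathbb N$ let $\mathcal P_n=\{X_1,\dots,X_n\}$ with $X_1,\dots,X_n$ independent and $\pi_d$-distributed, and for $\varepsilon\in(0,1)$ set $$\widetilde N(\varepsilon,d)=\min\{n\in\mathbb N:\ \mathbb E[\operatorname{disp}(\mathcal P_n;d)]\le\varepsilon\}.$$ Then for all $d\in\mathbb N$ and all $\varepsilon\in(0,\frac1{9e})$ the minimum exists and $$\max\Big\{\frac1\varepsilon+d-2,\ \frac1{2\varepsilon}+2d-2,\ \frac1{9\varepsilon}\log\Big(\frac1{9\varepsilon}\Big)\Big\}\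 \le\ \widetilde N(\varepsilon,d)\ \le\ 96\,\frac d\varepsilon\,\log\Big(\frac{96}\varepsilon\Big).$$ Consequently the dependence of the upper bound on $\varepsilon$ and on $d$ is individually optimal up to constants: for each fixed $d\in\mathbb N$, $\widetilde N(\varepsilon,d)=\Theta\big(\frac1\varepsilon\log\frac1\varepsilon\big)$ as $\varepsilon\to0^+$, and for each fixed $\varepsilon\in(0,\frac1{9e})$, $\widetilde N(\varepsilon,d)=\Theta(d)$ as $d\to\infty$. -/

import Mathlib

open MeasureTheory
open scoped ENNReal

namespace SphericalDispersion

/-- The Euclidean unit sphere `𝕊^d` of `ℝ^(d+1)`. -/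
abbrev Sph (d : ℕ) : Type :=
  Metric.sphere (0 : EuclideanSpace ℝ (Fin (d + 1))) 1

/-- The normalized surface measure (uniform distribution) `π_d` on `𝕊^d`: the surface measure
induced by Lebesgue measure on `ℝ^(d+1)`, divided by its total mass. -/
noncomputable def sphereMeasure (d : ℕ) : Measure (Sph d) :=
  ((volume : Measure (EuclideanSpace ℝ (Fin (d + 1)))).toSphere Set.univ)⁻¹ •
    (volume : Measure (EuclideanSpace ℝ (Fin (d + 1)))).toSphere

instance sphereMeasure_isProbabilityMeasure (d : ℕ) :
    IsProbabilityMeasure (sphereMeasure d) where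
  measure_univ := by
    have h0 : (volume : Measure (EuclideanSpace ℝ (Fin (d + 1)))).toSphere Set.univ ≠ 0 := by
      rw [Ne, Measure.measure_univ_eq_zero]
      exact Measure.toSphere_ne_zero _
    simp only [sphereMeasure, Measure.smul_apply, smul_eq_mul]
    exact ENNReal.inv_mul_cancel h0 (measure_ne_top _ _)

/-- The open spherical cap `C(x,t) = {y ∈ 𝕊^d : ⟨x,y⟩ > t}`. -/
def cap {d : ℕ} (x : Sph d) (t : ℝ) : Set (Sph d) :=
  {y | t < inner ℝ (x : EuclideanSpace ℝ (Fin (d + 1))) (y : EuclideanSpace ℝ (Fin (d + 1)))}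

/-- The family of spherical slices, i.e. of the intersections of two spherical caps. -/
def slices (d : ℕ) : Set (Set (Sph d)) :=
  {B | ∃ x y : Sph d, ∃ t ∈ Set.Icc (-1 : ℝ) 1, ∃ s ∈ Set.Icc (-1 : ℝ) 1,
    B = cap x t ∩ cap y s}

/-- The spherical dispersion of a point set `P ⊆ 𝕊^d`: the supremum of the measures of the
spherical slices that contain no point of `P`. -/
noncomputable def disp {d : ℕ} (P : Set (Sph d)) : ℝ≥0∞ :=
  ⨆ B ∈ {B ∈ slices d | P ∩ B = ∅}, sphereMeasure d B

/-- The expected dispersion of `{X_1, …, X_n}` for independent `π_d`-distributed `X_1, …, X_n`: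
the integral of the dispersion with respect to the joint law, the `n`-fold product of `π_d`. -/
noncomputable def expectedDisp (n d : ℕ) : ℝ≥0∞ :=
  ∫⁻ X : Fin n → Sph d, disp (Set.range X) ∂(Measure.pi fun _ : Fin n => sphereMeasure d)

/-- The positive numbers `n` of random points with expected dispersion at most `ε`. -/
noncomputable def admissible (ε : ℝ) (d : ℕ) : Set ℕ :=
  {n | 1 ≤ n ∧ expectedDisp n d ≤ ENNReal.ofReal ε}

/-- The inverse of the expected dispersion, `Ñ(ε,d)`: the least admissible number of points. -/
noncomputable def invExpectedDisp (ε : ℝ) (d : ℕ) : ℕ :=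
  sInf (admissible ε d)

end SphericalDispersion

/-!
Fix two orthonormal vectors `u, v`. The hyperplanes containing the orthogonal complement of the
plane of `u, v` cut the sphere, at equally spaced angles, into `N` lunes of measure `1 / N`, each of
which is a slice up to its boundary.

Lower bounds. Choosing `u, v` orthogonal to `d - 1` of the points leaves those points outside
every lune, so `N + d - 2` points miss one of the `N` lunes. If there are at most `3 d - 2` points,
take `w` orthogonal to `d` of them; one of the two open half-spaces bounded by the hyperplane `w^⊥`
then contains fewer than `d` points, and a second hyperplane through those points and `w` cuts an
empty lune of measure `1 / 4` out of that half-space.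
For random points the number of missed lunes is tested against its second moment: the events of
missing two different lunes are negatively correlated, so if the expected number of missed lunes
is at least one, then one of them is missed with probability at least `1 / 2`. The expectation is
`N (1 - 1 / N) ^ n`, which allows `n` of order `N log N`.

Upper bound. The measure of an empty slice is the expected proportion of a second independent
sample that it contains. Exchanging the two samples point by point, a slice that contains more than
`m` of the `2 n` points has an empty first half with probability at most `2 ^ (-m)`. By the
theorems of Radon and Sauer–Shelah, slices cut only polynomially many subsets out of `2 n` points,
and a union bound over these subsets concludes.
-/

namespace SphericalDispersion

open Metric Set
open scoped InnerProductSpace Real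

/-! ### Cones and the uniform distribution -/

theorem toSphere_preimage_val_of_cone {E : Type*} [NormedAddCommGroup E] [NormedSpace ℝ E]
    [MeasurableSpace E] [BorelSpace E] (μ : Measure E) {W : Set E} (hW : MeasurableSet W)
    (hcone : ∀ r : ℝ, 0 < r → ∀ x ∈ W, r • x ∈ W) :
    μ.toSphere (Subtype.val ⁻¹' W) = Module.finrank ℝ E * μ (W ∩ (ball 0 1 \ {0})) := by
  rw [Measure.toSphere_apply' _ (measurable_subtype_coe hW)]
  congr 2
  ext z
  constructor
  · rintro ⟨r, ⟨hr0, hr1⟩, _, ⟨x, hx, rfl⟩, rfl⟩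
    have hnorm : ‖r • (x : E)‖ = r := by
      rw [norm_smul, norm_eq_of_mem_sphere x, mul_one, Real.norm_of_nonneg hr0.le]
    refine ⟨hcone r hr0 x hx, mem_ball_zero_iff.2 (hnorm.trans_lt hr1), ?_⟩
    exact norm_ne_zero_iff.1 (hnorm.trans_ne hr0.ne')
  · rintro ⟨hzW, hz1, hz0⟩
    have hz : 0 < ‖z‖ := norm_pos_iff.2 hz0
    refine ⟨‖z‖, ⟨hz, mem_ball_zero_iff.1 hz1⟩, ‖z‖⁻¹ • z,
      ⟨⟨‖z‖⁻¹ • z, ?_⟩, hcone _ (inv_pos.2 hz) z hzW, rfl⟩, smul_inv_smul₀ hz.ne' z⟩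
    rw [mem_sphere_zero_iff_norm, norm_smul, norm_inv, norm_norm, inv_mul_cancel₀ hz.ne']

section Sphere

variable {d : ℕ}

theorem sphereMeasure_preimage_isometry_of_cone
    (A : EuclideanSpace ℝ (Fin (d + 1)) ≃ₗᵢ[ℝ] EuclideanSpace ℝ (Fin (d + 1)))
    {W : Set (EuclideanSpace ℝ (Fin (d + 1)))} (hW : MeasurableSet W)
    (hcone : ∀ r : ℝ, 0 < r → ∀ x ∈ W, r • x ∈ W) :
    sphereMeasure d (Subtype.val ⁻¹' (A ⁻¹' W)) = sphereMeasure d (Subtype.val ⁻¹' W) := by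
  have hball : A ⁻¹' W ∩ (ball 0 1 \ {0}) = A ⁻¹' (W ∩ (ball 0 1 \ {0})) := by
    ext x
    simp
  have hAcone : ∀ r : ℝ, 0 < r → ∀ x ∈ A ⁻¹' W, r • x ∈ A ⁻¹' W := fun r hr x hx => by
    simpa only [mem_preimage, map_smul] using hcone r hr (A x) hx
  simp only [sphereMeasure, Measure.smul_apply]
  rw [toSphere_preimage_val_of_cone _ (A.continuous.measurable hW) hAcone,
    toSphere_preimage_val_of_cone _ hW hcone, hball,
    A.measurePreserving.measure_preimage
      (hW.inter (measurableSet_ball.diff (measurableSet_singleton 0))).nullMeasurableSet]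

theorem sphereMeasure_inner_eq_zero {w : EuclideanSpace ℝ (Fin (d + 1))} (hw : w ≠ 0) :
    sphereMeasure d {y | ⟪w, y.1⟫_ℝ = 0} = 0 := by
  have hnull : volume {y | ⟪w, y⟫_ℝ = 0} = 0 := by
    have hker : {y | ⟪w, y⟫_ℝ = 0} = ((ℝ ∙ w)ᗮ : Submodule ℝ _) := by
      ext y
      exact Submodule.mem_orthogonal_singleton_iff_inner_right.symm
    rw [hker]
    refine Measure.addHaar_submodule _ _ fun htop => hw ?_
    rwa [Submodule.orthogonal_eq_top_iff, Submodule.span_singleton_eq_bot] at htop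
  have hcone : ∀ r : ℝ, 0 < r → ∀ y ∈ {y | ⟪w, y⟫_ℝ = 0}, r • y ∈ {y | ⟪w, y⟫_ℝ = 0} :=
    fun r _ y hy => (inner_smul_right w y r).trans (by rw [hy, mul_zero])
  have hsphere := toSphere_preimage_val_of_cone volume
    (isClosed_eq (by fun_prop : Continuous fun y => ⟪w, y⟫_ℝ) continuous_const).measurableSet hcone
  rw [measure_mono_null inter_subset_left hnull, mul_zero] at hsphere
  simp only [sphereMeasure, Measure.smul_apply]
  exact (congrArg _ hsphere).trans (smul_zero _)

end Sphere

/-! ### Wedges in an inner product space -/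

section Wedge

variable {E : Type*} [NormedAddCommGroup E] [InnerProductSpace ℝ E]

theorem exists_unit_orthogonal [FiniteDimensional ℝ E] (s : Finset E)
    (hs : s.card < Module.finrank ℝ E) : ∃ u : E, ‖u‖ = 1 ∧ ∀ x ∈ s, ⟪u, x⟫_ℝ = 0 := by
  have hne : (Submodule.span ℝ (s : Set E))ᗮ ≠ ⊥ := by
    rw [Ne, Submodule.orthogonal_eq_bot_iff]
    intro htop
    have hspan := finrank_span_finset_le_card (R := ℝ) s
    rw [Set.finrank, htop, finrank_top] at hspan
    omega
  obtain ⟨z, hz, hz0⟩ := Submodule.exists_mem_ne_zero_of_ne_bot hne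
  refine ⟨‖z‖⁻¹ • z, norm_smul_inv_norm hz0, fun x hx => ?_⟩
  rw [real_inner_smul_left, real_inner_comm, hz x (Submodule.subset_span hx), mul_zero]

theorem orthonormal_pair_iff {u v : E} :
    Orthonormal ℝ ![u, v] ↔ ‖u‖ = 1 ∧ ‖v‖ = 1 ∧ ⟪u, v⟫_ℝ = 0 := by
  simp only [Nat.succ_eq_add_one, Nat.reduceAdd, orthonormal_vecCons_iff,
    Matrix.cons_val_fin_one, forall_const, orthonormal_subsingleton_iff]
  tauto

theorem exists_orthonormal_pair_orthogonal [FiniteDimensional ℝ E] (s : Finset E)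
    (hs : s.card + 1 < Module.finrank ℝ E) :
    ∃ u v : E, Orthonormal ℝ ![u, v] ∧ ∀ x ∈ s, ⟪u, x⟫_ℝ = 0 ∧ ⟪v, x⟫_ℝ = 0 := by
  classical
  obtain ⟨u, hu, hus⟩ := exists_unit_orthogonal s (by omega)
  obtain ⟨v, hv, hvs⟩ := exists_unit_orthogonal (insert u s)
    ((Finset.card_insert_le _ _).trans_lt hs)
  refine ⟨u, v, orthonormal_pair_iff.2 ⟨hu, hv, ?_⟩,
    fun x hx => ⟨hus x hx, hvs x (Finset.mem_insert_of_mem hx)⟩⟩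
  rw [real_inner_comm]
  exact hvs u (Finset.mem_insert_self u s)

/-- For orthonormal `u` and `v`, the unit normal vector of the hyperplane that contains
`cos θ • u + sin θ • v` and the orthogonal complement of the plane spanned by `u` and `v`. -/
noncomputable def normal (u v : E) (θ : ℝ) : E :=
  Real.cos θ • v - Real.sin θ • u

theorem inner_normal (u v : E) (θ : ℝ) (y : E) :
    ⟪normal u v θ, y⟫_ℝ = Real.cos θ * ⟪v, y⟫_ℝ - Real.sin θ * ⟪u, y⟫_ℝ := by
  rw [normal, inner_sub_left, real_inner_smul_left, real_inner_smul_left]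

theorem normal_add_add_normal_sub (u v : E) (θ s : ℝ) :
    normal u v (θ + s) + normal u v (θ - s) = (2 * Real.cos s) • normal u v θ := by
  simp only [normal, Real.cos_add, Real.cos_sub, Real.sin_add, Real.sin_sub]
  module

section Orthonormal

variable {u v : E} (huv : Orthonormal ℝ ![u, v])
include huv

theorem inner_normal_normal (θ φ : ℝ) :
    ⟪normal u v θ, normal u v φ⟫_ℝ = Real.cos (θ - φ) := by
  obtain ⟨hu, hv, huv⟩ := orthonormal_pair_iff.1 huv
  have hvu : ⟪v, u⟫_ℝ = 0 := by rw [real_inner_comm, huv]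
  simp only [normal, inner_sub_left, inner_sub_right, real_inner_smul_left, real_inner_smul_right,
    real_inner_self_eq_norm_sq, hu, hv, huv, hvu, Real.cos_sub]
  ring

theorem norm_normal (θ : ℝ) : ‖normal u v θ‖ = 1 := by
  rw [norm_eq_sqrt_real_inner, inner_normal_normal huv, sub_self, Real.cos_zero, Real.sqrt_one]

theorem reflection_normal_add (θ s : ℝ) :
    (ℝ ∙ normal u v θ)ᗮ.reflection (normal u v (θ + s)) = -normal u v (θ - s) := by
  have hsub : normal u v (θ - s) = (2 * Real.cos s) • normal u v θ - normal u v (θ + s) :=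
    eq_sub_of_add_eq' (normal_add_add_normal_sub u v θ s)
  rw [Submodule.reflection_orthogonal_apply, Submodule.reflection_singleton_apply,
    norm_normal huv, inner_normal_normal huv, sub_add_cancel_left, Real.cos_neg, hsub]
  simp only [RCLike.ofReal_real_eq_id, id_eq, one_pow, div_one]
  module

end Orthonormal

/-- For `0 ≤ α ≤ π`, the points whose projection to the plane spanned by the orthonormal vectors
`u` and `v` has a polar angle strictly between `j * α` and `(j + 1) * α`, as an intersection of two
open half-spaces. -/
def wedge (u v : E) (α : ℝ) (j : ℕ) : Set E :=
  {y | 0 < ⟪normal u v (j * α), y⟫_ℝ ∧ ⟪normal u v ((j + 1) * α), y⟫_ℝ < 0}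

theorem isOpen_wedge (u v : E) (α : ℝ) (j : ℕ) : IsOpen (wedge u v α j) :=
  have hcont (θ : ℝ) : Continuous fun y => ⟪normal u v θ, y⟫_ℝ := by fun_prop
  (isOpen_lt continuous_const (hcont _)).inter (isOpen_lt (hcont _) continuous_const)

theorem smul_mem_wedge {u v : E} {α : ℝ} {j : ℕ} (r : ℝ) (hr : 0 < r) (y : E)
    (hy : y ∈ wedge u v α j) : r • y ∈ wedge u v α j := by
  refine ⟨?_, ?_⟩ <;> rw [real_inner_smul_right]
  exacts [mul_pos hr hy.1, mul_neg_of_pos_of_neg hr hy.2]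

theorem reflection_preimage_wedge_succ {u v : E} (huv : Orthonormal ℝ ![u, v]) (α : ℝ) (j : ℕ) :
    (ℝ ∙ normal u v ((j + 1) * α))ᗮ.reflection ⁻¹' wedge u v α (j + 1) = wedge u v α j := by
  set θ : ℝ := (j + 1) * α
  have hreflect (s : ℝ) (y : E) :
      ⟪normal u v (θ + s), (ℝ ∙ normal u v θ)ᗮ.reflection y⟫_ℝ = -⟪normal u v (θ - s), y⟫_ℝ := by
    rw [← Submodule.reflection_symm, ← LinearIsometryEquiv.inner_map_eq_flip,
      reflection_normal_add huv, inner_neg_left]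
  ext y
  have hmid := hreflect 0 y
  have hnext := hreflect α y
  rw [add_zero, sub_zero] at hmid
  rw [show θ + α = (j + 1 + 1) * α by ring, show θ - α = j * α by ring] at hnext
  simp only [wedge, mem_preimage, mem_ofPred_eq, Nat.cast_add, Nat.cast_one]
  rw [hnext, show ((j : ℝ) + 1) * α = θ from rfl, hmid, neg_pos, neg_lt_zero, and_comm]

theorem exists_polar (u v y : E) :
    ∃ r φ : ℝ, 0 ≤ r ∧ 0 ≤ φ ∧ φ < 2 * π ∧
      ∀ θ, ⟪normal u v θ, y⟫_ℝ = r * Real.sin (φ - θ) := by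
  set z : ℂ := ⟨⟪u, y⟫_ℝ, ⟪v, y⟫_ℝ⟩
  refine ⟨‖z‖, toIcoMod Real.two_pi_pos 0 z.arg, norm_nonneg z, left_le_toIcoMod .., ?_,
    fun θ => ?_⟩
  · simpa only [zero_add] using toIcoMod_lt_right Real.two_pi_pos 0 z.arg
  · have hre : ‖z‖ * Real.cos z.arg = ⟪u, y⟫_ℝ := Complex.norm_mul_cos_arg z
    have him : ‖z‖ * Real.sin z.arg = ⟪v, y⟫_ℝ := Complex.norm_mul_sin_arg z
    rw [inner_normal, ← hre, ← him, toIcoMod, zsmul_eq_mul, sub_right_comm,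
      Real.sin_sub_int_mul_two_pi, Real.sin_sub]
    ring

theorem mem_Ioo_of_sin_pos_of_sin_sub_neg {x α : ℝ} (hα : 0 ≤ α) (hx : x ≤ 2 * π)
    (hxα : -(2 * π) ≤ x - α) (hsin : 0 < Real.sin x) (hsin' : Real.sin (x - α) < 0) :
    x ∈ Ioo 0 α := by
  constructor
  · by_contra! hx0
    have hxπ : x < -π := by
      by_contra! h
      exact hsin.not_ge (Real.sin_nonpos_of_nonpos_of_neg_pi_le hx0 h)
    refine hsin'.not_ge ?_
    rw [← Real.sin_add_two_pi]
    exact Real.sin_nonneg_of_nonneg_of_le_pi (by linarith) (by linarith)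
  · by_contra! hαx
    have hπx : π < x - α := by
      by_contra! h
      exact hsin'.not_ge (Real.sin_nonneg_of_nonneg_of_le_pi (sub_nonneg.2 hαx) h)
    refine hsin.not_ge ?_
    rw [← Real.sin_sub_two_pi]
    exact Real.sin_nonpos_of_nonpos_of_neg_pi_le (by linarith) (by linarith)

theorem pairwise_disjoint_wedge (u v : E) (N : ℕ) :
    Pairwise (Function.onFun Disjoint fun j : Fin N => wedge u v (2 * π / N) j) := by
  intro j k hjk
  refine Set.disjoint_left.2 fun y hyj hyk => hjk (Fin.ext ?_)
  obtain ⟨r, φ, hr, hφ0, hφ, hpolar⟩ := exists_polar u v y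
  have hN : (0 : ℝ) < N := Nat.cast_pos.2 j.pos
  set α := 2 * π / N with hα
  have hα0 : 0 < α := by positivity
  have hangle (i : Fin N) (hy : y ∈ wedge u v α i) : φ - i * α ∈ Ioo 0 α := by
    obtain ⟨hpos, hneg⟩ := hy
    rw [hpolar] at hpos hneg
    have hi : ((i : ℝ) + 1) * α ≤ 2 * π := by
      rw [hα, mul_div_assoc', div_le_iff₀ hN, mul_comm]
      gcongr
      exact_mod_cast i.2
    have hi0 : 0 ≤ (i : ℝ) * α := by positivity
    have hsub : φ - i * α - α = φ - (i + 1) * α := by ring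
    refine mem_Ioo_of_sin_pos_of_sin_sub_neg hα0.le (by linarith) (by linarith)
      (pos_of_mul_pos_right hpos hr) ?_
    rw [hsub]
    exact neg_of_mul_neg_right hneg hr
  have hj := hangle j hyj
  have hk := hangle k hyk
  have hjk : (j : ℝ) < k + 1 := lt_of_mul_lt_mul_right (by linarith [hj.1, hk.2]) hα0.le
  have hkj : (k : ℝ) < j + 1 := lt_of_mul_lt_mul_right (by linarith [hk.1, hj.2]) hα0.le
  norm_cast at hjk hkj
  omega

theorem exists_mem_wedge {u v : E} {N : ℕ} (hN : 2 ≤ N) {y : E}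
    (hy : ∀ j : ℕ, ⟪normal u v (j * (2 * π / N)), y⟫_ℝ ≠ 0) :
    ∃ j : Fin N, y ∈ wedge u v (2 * π / N) j := by
  obtain ⟨r, φ, hr, hφ0, hφ, hpolar⟩ := exists_polar u v y
  have hN2 : (2 : ℝ) ≤ N := by exact_mod_cast hN
  set α := 2 * π / N with hα
  have hα0 : 0 < α := by positivity
  have hαπ : α ≤ π := by
    rw [hα, div_le_iff₀ (by positivity), mul_comm]
    gcongr
  set j := ⌊φ / α⌋₊
  have hjφ : j * α ≤ φ := (le_div_iff₀ hα0).1 (Nat.floor_le (by positivity))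
  have hφj : φ < (j + 1) * α := (div_lt_iff₀ hα0).1 (Nat.lt_floor_add_one _)
  have hjN : j < N := by
    rw [Nat.floor_lt (by positivity), div_lt_iff₀ hα0, hα, mul_div_cancel₀ _ (by positivity)]
    exact hφ
  refine ⟨⟨j, hjN⟩, lt_of_le_of_ne ?_ (hy j).symm,
    lt_of_le_of_ne ?_ (by exact_mod_cast hy (j + 1))⟩ <;> rw [hpolar]
  · exact mul_nonneg hr (Real.sin_nonneg_of_nonneg_of_le_pi (by linarith) (by linarith))
  · exact mul_nonpos_of_nonneg_of_nonpos hr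
      (Real.sin_nonpos_of_nonpos_of_neg_pi_le (by linarith) (by linarith))

end Wedge

/-! ### Lunes -/

section Lune

variable {d : ℕ}

/-- The part of the sphere in the `j`-th of the `N` wedges of angle `2π / N` around the orthogonal
complement of the plane spanned by the orthonormal vectors `u` and `v`. -/
def lune (u v : EuclideanSpace ℝ (Fin (d + 1))) (N : ℕ) (j : Fin N) : Set (Sph d) :=
  Subtype.val ⁻¹' wedge u v (2 * π / N) j

theorem measurableSet_lune (u v : EuclideanSpace ℝ (Fin (d + 1))) (N : ℕ) (j : Fin N) :
    MeasurableSet (lune u v N j) :=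
  measurable_subtype_coe (isOpen_wedge u v _ j).measurableSet

theorem pairwise_disjoint_lune (u v : EuclideanSpace ℝ (Fin (d + 1))) (N : ℕ) :
    Pairwise (Function.onFun Disjoint (lune u v N)) :=
  fun _ _ hjk => (pairwise_disjoint_wedge u v N hjk).preimage _

variable {u v : EuclideanSpace ℝ (Fin (d + 1))} (huv : Orthonormal ℝ ![u, v])
include huv

theorem lune_mem_slices (N : ℕ) (j : Fin N) : lune u v N j ∈ slices d := by
  have hmem (θ : ℝ) : normal u v θ ∈ sphere 0 1 :=
    mem_sphere_zero_iff_norm.2 (norm_normal huv θ)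
  refine ⟨⟨_, hmem (j * (2 * π / N))⟩, -⟨_, hmem ((j + 1) * (2 * π / N))⟩,
    0, by norm_num, 0, by norm_num, ?_⟩
  ext y
  simp only [lune, wedge, cap, mem_preimage, mem_inter_iff, mem_ofPred_eq, coe_neg_sphere,
    inner_neg_left, neg_pos]

theorem sphereMeasure_lune_eq_lune {N : ℕ} (j k : Fin N) :
    sphereMeasure d (lune u v N j) = sphereMeasure d (lune u v N k) := by
  suffices h : ∀ i : ℕ, sphereMeasure d (Subtype.val ⁻¹' wedge u v (2 * π / N) i) =
      sphereMeasure d (Subtype.val ⁻¹' wedge u v (2 * π / N) 0) from (h j).trans (h k).symm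
  intro i
  induction i with
  | zero => rfl
  | succ i ih =>
    rw [← ih, ← reflection_preimage_wedge_succ huv _ i, sphereMeasure_preimage_isometry_of_cone _
      (isOpen_wedge u v _ _).measurableSet smul_mem_wedge]

theorem ae_mem_iUnion_lune {N : ℕ} (hN : 2 ≤ N) :
    ∀ᵐ y ∂sphereMeasure d, y ∈ ⋃ j, lune u v N j := by
  have hnonzero : ∀ᵐ y ∂sphereMeasure d, ∀ j : ℕ, ⟪normal u v (j * (2 * π / N)), y.1⟫_ℝ ≠ 0 :=
    ae_all_iff.2 fun j => by
      have h := sphereMeasure_inner_eq_zero (norm_ne_zero_iff.1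
        ((norm_normal huv (j * (2 * π / N))).trans_ne one_ne_zero))
      simpa only [ae_iff, ne_eq, not_not] using h
  filter_upwards [hnonzero] with y hy
  exact mem_iUnion.2 (exists_mem_wedge hN hy)

theorem sphereMeasure_lune {N : ℕ} (hN : 2 ≤ N) (j : Fin N) :
    sphereMeasure d (lune u v N j) = (N : ℝ≥0∞)⁻¹ := by
  have hsum : ∑ k, sphereMeasure d (lune u v N k) = 1 := by
    have hunion : sphereMeasure d (⋃ k, lune u v N k) = 1 :=
      (measure_congr (Filter.eventuallyEq_univ.2 (ae_mem_iUnion_lune huv hN))).trans measure_univ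
    rwa [measure_iUnion (pairwise_disjoint_lune u v N) (measurableSet_lune u v N),
      tsum_fintype] at hunion
  simp only [sphereMeasure_lune_eq_lune huv _ j, Finset.sum_const, Finset.card_univ,
    Fintype.card_fin, nsmul_eq_mul] at hsum
  exact ENNReal.eq_inv_of_mul_eq_one_left (by rwa [mul_comm])

end Lune

/-! ### Lower bounds for the dispersion of arbitrary points -/

section Deterministic

variable {d : ℕ}

theorem le_disp {P B : Set (Sph d)} (hB : B ∈ slices d) (hPB : Disjoint P B) :
    sphereMeasure d B ≤ disp P :=
  le_iSup₂_of_le B ⟨hB, hPB.inter_eq⟩ le_rfl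

theorem inv_le_disp_of_disjoint_lune {u v : EuclideanSpace ℝ (Fin (d + 1))}
    (huv : Orthonormal ℝ ![u, v]) {N : ℕ} (hN : 2 ≤ N) {j : Fin N} {P : Set (Sph d)}
    (hP : Disjoint P (lune u v N j)) : (N : ℝ≥0∞)⁻¹ ≤ disp P :=
  (sphereMeasure_lune huv hN j).symm.trans_le (le_disp (lune_mem_slices huv N j) hP)

theorem exists_forall_notMem_of_card_lt {α ι : Type*} [Fintype ι] {s : ι → Set α}
    (hs : Pairwise (Function.onFun Disjoint s)) {P : Finset α} (hP : P.card < Fintype.card ι) :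
    ∃ i, ∀ y ∈ P, y ∉ s i := by
  by_contra! h
  choose f hfP hfs using h
  obtain ⟨i, -, j, -, hij, hf⟩ :=
    Finset.exists_ne_map_eq_of_card_lt_of_maps_to hP (s := Finset.univ) fun i _ => hfP i
  exact Set.disjoint_left.1 (hs hij) (hfs i) (hf ▸ hfs j)

theorem inv_le_disp {N : ℕ} (hd : 1 ≤ d) (hN : 2 ≤ N) {P : Finset (Sph d)}
    (hP : P.card + 2 ≤ N + d) : (N : ℝ≥0∞)⁻¹ ≤ disp (P : Set (Sph d)) := by
  classical
  obtain ⟨Q, hQP, hQ⟩ := Finset.exists_subset_card_eq (min_le_right (d - 1) P.card)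
  obtain ⟨u, v, huv, horth⟩ := exists_orthonormal_pair_orthogonal (Q.image Subtype.val) (by
    rw [finrank_euclideanSpace_fin]
    exact (Nat.add_le_add_right Finset.card_image_le 1).trans_lt (by omega))
  have hQlune (j : Fin N) : ∀ y ∈ Q, y ∉ lune u v N j := fun y hy hyj => by
    obtain ⟨huy, hvy⟩ := horth y (Finset.mem_image_of_mem _ hy)
    refine hyj.1.ne' ?_
    rw [inner_normal, huy, hvy, mul_zero, mul_zero, sub_zero]
  obtain ⟨j, hj⟩ := exists_forall_notMem_of_card_lt (pairwise_disjoint_lune u v N)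
    (P := P \ Q) (by rw [Finset.card_sdiff_of_subset hQP, Fintype.card_fin]; omega)
  refine inv_le_disp_of_disjoint_lune huv hN (j := j) (Set.disjoint_left.2 fun y hy => ?_)
  by_cases hyQ : y ∈ Q
  · exact hQlune j y hyQ
  · exact hj y (Finset.mem_sdiff.2 ⟨hy, hyQ⟩)

theorem exists_unit_card_filter_inner_pos_lt {P : Finset (Sph d)}
    (hP : P.card + 2 ≤ 3 * d) : ∃ w : EuclideanSpace ℝ (Fin (d + 1)), ‖w‖ = 1 ∧
      (P.filter fun y => 0 < ⟪w, y.1⟫_ℝ).card < d := by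
  classical
  obtain ⟨Q, hQP, hQ⟩ := Finset.exists_subset_card_eq (min_le_right d P.card)
  obtain ⟨w, hw, horth⟩ := exists_unit_orthogonal (Q.image Subtype.val) (by
    rw [finrank_euclideanSpace_fin]
    exact Finset.card_image_le.trans_lt (by omega))
  set A := P.filter fun y => 0 < ⟪w, y.1⟫_ℝ
  set B := P.filter fun y => 0 < ⟪-w, y.1⟫_ℝ
  have hAB : Disjoint A B := Finset.disjoint_filter.2 fun y _ hpos hneg => by
    rw [inner_neg_left, neg_pos] at hneg
    exact lt_asymm hpos hneg
  have hsub : A ∪ B ⊆ P \ Q := by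
    rw [← Finset.filter_or]
    refine fun y hy => Finset.mem_sdiff.2 ⟨(Finset.mem_filter.1 hy).1, fun hyQ => ?_⟩
    simpa [horth y (Finset.mem_image_of_mem _ hyQ)] using (Finset.mem_filter.1 hy).2
  have hcard := Finset.card_le_card hsub
  rw [Finset.card_union_of_disjoint hAB, Finset.card_sdiff_of_subset hQP, hQ] at hcard
  rcases lt_or_ge A.card d with hA | hA
  · exact ⟨w, hw, hA⟩
  · exact ⟨-w, by rw [norm_neg, hw], (by omega : B.card < d)⟩

theorem quarter_le_disp {P : Finset (Sph d)} (hP : P.card + 2 ≤ 3 * d) :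
    (4 : ℝ≥0∞)⁻¹ ≤ disp (P : Set (Sph d)) := by
  classical
  obtain ⟨w, hw, hfew⟩ := exists_unit_card_filter_inner_pos_lt hP
  obtain ⟨v, hv, horth⟩ := exists_unit_orthogonal
    (insert w ((P.filter fun y => 0 < ⟪w, y.1⟫_ℝ).image Subtype.val)) (by
      rw [finrank_euclideanSpace_fin]
      exact (Finset.card_insert_le _ _).trans_lt
        (Nat.succ_lt_succ (Finset.card_image_le.trans_lt hfew)))
  have hwv : Orthonormal ℝ ![w, v] := orthonormal_pair_iff.2
    ⟨hw, hv, by rw [real_inner_comm]; exact horth w (Finset.mem_insert_self w _)⟩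
  refine inv_le_disp_of_disjoint_lune hwv (N := 4) (j := 0) (by norm_num)
    (Set.disjoint_left.2 fun y hy hlune => ?_)
  obtain ⟨hv_pos, hw_neg⟩ := hlune
  have hangle : ((0 : ℝ) + 1) * (2 * π / 4) = π / 2 := by ring
  simp only [inner_normal, Fin.coe_ofNat_eq_mod, Nat.zero_mod, Nat.cast_zero, Nat.cast_ofNat,
    hangle, zero_mul, Real.cos_zero, Real.sin_zero, one_mul, sub_zero, Real.cos_pi_div_two,
    Real.sin_pi_div_two, zero_sub, neg_lt_zero] at hv_pos hw_neg
  refine hv_pos.ne' (horth y (Finset.mem_insert_of_mem (Finset.mem_image_of_mem _ ?_)))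
  exact Finset.mem_filter.2 ⟨hy, hw_neg⟩

theorem le_expectedDisp {n : ℕ} {c : ℝ≥0∞}
    (h : ∀ P : Finset (Sph d), P.card ≤ n → c ≤ disp (P : Set (Sph d))) :
    c ≤ expectedDisp n d := by
  classical
  have hrange (X : Fin n → Sph d) : c ≤ disp (Set.range X) := by
    have hcard : (Finset.univ.image X).card ≤ n := by
      simpa only [Finset.card_univ, Fintype.card_fin] using
        (Finset.card_image_le (s := Finset.univ) (f := X))
    simpa only [Finset.coe_image, Finset.coe_univ, Set.image_univ] using h _ hcard
  calc c = ∫⁻ _ : Fin n → Sph d, c ∂(Measure.pi fun _ : Fin n => sphereMeasure d) := by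
        rw [lintegral_const, measure_univ, mul_one]
    _ ≤ expectedDisp n d := lintegral_mono hrange

end Deterministic

/-! ### Second moment lower bound for random points -/

section SecondMoment

variable {Ω : Type*} [MeasurableSpace Ω] (μ : Measure Ω) {ι : Type*} [Fintype ι]

theorem sq_integral_le_measureReal_mul_integral_sq [IsFiniteMeasure μ] {f : Ω → ℝ} {s : Set Ω}
    (hs : MeasurableSet s) (hf : Integrable f μ) (hf2 : Integrable (fun ω => f ω ^ 2) μ)
    (hfs : ∀ ω ∉ s, f ω = 0) : (∫ ω, f ω ∂μ) ^ 2 ≤ μ.real s * ∫ ω, f ω ^ 2 ∂μ := by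
  have hint : Integrable (s.indicator (1 : Ω → ℝ)) μ := (integrable_const (1 : ℝ)).indicator hs
  have hexpand (x : ℝ) (ω : Ω) : (x * s.indicator 1 ω - f ω) ^ 2 =
      x * x * s.indicator 1 ω + -2 * x * f ω + f ω ^ 2 := by
    by_cases hω : ω ∈ s
    · rw [Set.indicator_of_mem hω, Pi.one_apply]
      ring
    · rw [Set.indicator_of_notMem hω, hfs ω hω]
      ring
  have hdiscrim : discrim (μ.real s) (-2 * ∫ ω, f ω ∂μ) (∫ ω, f ω ^ 2 ∂μ) ≤ 0 :=
    discrim_le_zero fun x => by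
      have hlin : Integrable (fun ω => x * x * s.indicator 1 ω + -2 * x * f ω) μ :=
        (hint.const_mul _).add (hf.const_mul _)
      calc 0 ≤ ∫ ω, (x * s.indicator 1 ω - f ω) ^ 2 ∂μ := integral_nonneg fun ω => sq_nonneg _
        _ = _ := by
          simp only [hexpand]
          rw [integral_add hlin hf2, integral_add (hint.const_mul _) (hf.const_mul _),
            integral_const_mul, integral_const_mul, integral_indicator_one hs]
          ring
  rw [discrim] at hdiscrim
  linarith

theorem sq_sum_measureReal_le [IsFiniteMeasure μ] {A : ι → Set Ω}
    (hA : ∀ i, MeasurableSet (A i)) :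
    (∑ i, μ.real (A i)) ^ 2 ≤ μ.real (⋃ i, A i) * ∑ i, ∑ j, μ.real (A i ∩ A j) := by
  set count : Ω → ℝ := fun ω => ∑ i, (A i).indicator 1 ω
  have hint {s : Set Ω} (hs : MeasurableSet s) : Integrable (s.indicator (1 : Ω → ℝ)) μ :=
    (integrable_const (1 : ℝ)).indicator hs
  have hcount : ∫ ω, count ω ∂μ = ∑ i, μ.real (A i) :=
    (integral_finsetSum _ fun i _ => hint (hA i)).trans
      (Finset.sum_congr rfl fun i _ => integral_indicator_one (hA i))
  have hsq (ω : Ω) : count ω ^ 2 = ∑ i, ∑ j, (A i ∩ A j).indicator (1 : Ω → ℝ) ω := by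
    simp only [count, sq, Finset.sum_mul_sum, Set.inter_indicator_one, Pi.mul_apply]
  have hrow_int (i : ι) : Integrable (fun ω => ∑ j, (A i ∩ A j).indicator (1 : Ω → ℝ) ω) μ :=
    integrable_finsetSum _ fun j _ => hint ((hA i).inter (hA j))
  have hcount_sq : ∫ ω, count ω ^ 2 ∂μ = ∑ i, ∑ j, μ.real (A i ∩ A j) := by
    simp only [hsq]
    rw [integral_finsetSum _ fun i _ => hrow_int i]
    refine Finset.sum_congr rfl fun i _ => ?_
    rw [integral_finsetSum _ fun j _ => hint ((hA i).inter (hA j))]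
    exact Finset.sum_congr rfl fun j _ => integral_indicator_one ((hA i).inter (hA j))
  rw [← hcount, ← hcount_sq]
  refine sq_integral_le_measureReal_mul_integral_sq μ (MeasurableSet.iUnion hA)
    (integrable_finsetSum _ fun i _ => hint (hA i)) ?_ fun ω hω => ?_
  · simp only [hsq]
    exact integrable_finsetSum _ fun i _ => hrow_int i
  · exact Finset.sum_eq_zero fun i _ =>
      Set.indicator_of_notMem (fun h => hω (Set.mem_iUnion.2 ⟨i, h⟩)) _

theorem half_le_measureReal_iUnion [IsFiniteMeasure μ] {A : ι → Set Ω}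
    (hA : ∀ i, MeasurableSet (A i))
    (hcorr : ∀ i j, i ≠ j → μ.real (A i ∩ A j) ≤ μ.real (A i) * μ.real (A j))
    (hsum : 1 ≤ ∑ i, μ.real (A i)) : 1 / 2 ≤ μ.real (⋃ i, A i) := by
  classical
  set m := ∑ i, μ.real (A i) with hm
  have hpair (i j : ι) : μ.real (A i ∩ A j) ≤
      (if j = i then μ.real (A i) else 0) + μ.real (A i) * μ.real (A j) := by
    split_ifs with h
    · subst h
      rw [Set.inter_self]
      exact le_add_of_nonneg_right (by positivity)
    · simpa only [zero_add] using hcorr i j (Ne.symm h)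
  have hsecond : ∑ i, ∑ j, μ.real (A i ∩ A j) ≤ m + m ^ 2 :=
    calc ∑ i, ∑ j, μ.real (A i ∩ A j) ≤
          ∑ i, ∑ j, ((if j = i then μ.real (A i) else 0) + μ.real (A i) * μ.real (A j)) :=
          Finset.sum_le_sum fun i _ => Finset.sum_le_sum fun j _ => hpair i j
      _ = m + m ^ 2 := by
        simp only [Finset.sum_add_distrib, Finset.sum_ite_eq', Finset.mem_univ, if_true,
          ← Finset.sum_mul_sum, ← hm, sq]
  have hce : m * m ≤ m * (μ.real (⋃ i, A i) * (1 + m)) :=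
    calc m * m ≤ μ.real (⋃ i, A i) * ∑ i, ∑ j, μ.real (A i ∩ A j) := by
          simpa only [sq] using sq_sum_measureReal_le μ hA
      _ ≤ μ.real (⋃ i, A i) * (m + m ^ 2) := by gcongr
      _ = m * (μ.real (⋃ i, A i) * (1 + m)) := by ring
  have hle := le_of_mul_le_mul_left hce (by linarith)
  nlinarith [measureReal_nonneg (μ := μ) (s := ⋃ i, A i)]

theorem half_le_measureReal_pi_iUnion_compl [IsProbabilityMeasure μ] {κ : Type*} [Fintype κ]
    {L : ι → Set Ω} (hL : ∀ i, MeasurableSet (L i)) (hdisj : Pairwise (Function.onFun Disjoint L))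
    {p : ℝ} (hp : ∀ i, μ.real (L i) = p)
    (hcard : 1 ≤ Fintype.card ι * (1 - p) ^ Fintype.card κ) :
    1 / 2 ≤ (Measure.pi fun _ : κ => μ).real (⋃ i, Set.univ.pi fun _ => (L i)ᶜ) := by
  have hpi (s : Set Ω) : (Measure.pi fun _ : κ => μ).real (Set.univ.pi fun _ => s) =
      μ.real s ^ Fintype.card κ := by
    simp only [Measure.real, Measure.pi_pi, Finset.prod_const, Finset.card_univ,
      ENNReal.toReal_pow]
  have hmiss (i : ι) : μ.real (L i)ᶜ = 1 - p := by rw [probReal_compl_eq_one_sub (hL i), hp]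
  refine half_le_measureReal_iUnion _ (fun i => .univ_pi fun _ => (hL i).compl)
    (fun i j hij => ?_) ?_
  · have hmiss₂ : μ.real ((L i)ᶜ ∩ (L j)ᶜ) = 1 - 2 * p := by
      rw [← Set.compl_union, probReal_compl_eq_one_sub ((hL i).union (hL j)),
        measureReal_union (hdisj hij) (hL j), hp, hp, two_mul]
    rw [← Set.pi_inter_distrib, hpi, hpi, hpi, hmiss, hmiss, hmiss₂, ← mul_pow]
    exact pow_le_pow_left₀ (hmiss₂ ▸ measureReal_nonneg) (by nlinarith [sq_nonneg p]) _
  · simpa only [hpi, hmiss, Finset.sum_const, Finset.card_univ, nsmul_eq_mul] using hcard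

end SecondMoment

theorem one_div_two_mul_le_expectedDisp {n d N : ℕ} (hd : 1 ≤ d) (hN : 2 ≤ N)
    (hn : 1 ≤ N * (1 - (N : ℝ)⁻¹) ^ n) : ENNReal.ofReal (1 / (2 * N)) ≤ expectedDisp n d := by
  obtain ⟨u, v, huv, -⟩ := exists_orthonormal_pair_orthogonal
    (∅ : Finset (EuclideanSpace ℝ (Fin (d + 1)))) (by
      rw [finrank_euclideanSpace_fin, Finset.card_empty]; omega)
  set μ := Measure.pi fun _ : Fin n => sphereMeasure d
  set missed : Set (Fin n → Sph d) := ⋃ j, Set.univ.pi fun _ => (lune u v N j)ᶜ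
  have hmissed : MeasurableSet missed :=
    .iUnion fun j => .univ_pi fun _ => (measurableSet_lune u v N j).compl
  have hhalf : ENNReal.ofReal (1 / 2) ≤ μ missed := by
    refine (ENNReal.ofReal_le_iff_le_toReal (measure_ne_top _ _)).2
      (half_le_measureReal_pi_iUnion_compl _ (measurableSet_lune u v N)
        (pairwise_disjoint_lune u v N) (p := (N : ℝ)⁻¹) (fun j => ?_) ?_)
    · rw [Measure.real, sphereMeasure_lune huv hN, ENNReal.toReal_inv, ENNReal.toReal_natCast]
    · simpa only [Fintype.card_fin] using hn
  have hdisp (X : Fin n → Sph d) :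
      missed.indicator (fun _ => (N : ℝ≥0∞)⁻¹) X ≤ disp (Set.range X) := by
    refine Set.indicator_apply_le' (fun hX => ?_) fun _ => zero_le
    obtain ⟨j, hj⟩ := Set.mem_iUnion.1 hX
    refine inv_le_disp_of_disjoint_lune huv hN (j := j) (Set.disjoint_left.2 ?_)
    rintro _ ⟨i, rfl⟩
    exact hj i trivial
  calc ENNReal.ofReal (1 / (2 * N)) = (N : ℝ≥0∞)⁻¹ * ENNReal.ofReal (1 / 2) := by
        rw [← ENNReal.ofReal_natCast, ← ENNReal.ofReal_inv_of_pos (by positivity),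
          ← ENNReal.ofReal_mul (by positivity)]
        congr 1
        ring
    _ ≤ (N : ℝ≥0∞)⁻¹ * μ missed := by gcongr
    _ = ∫⁻ X, missed.indicator (fun _ => (N : ℝ≥0∞)⁻¹) X ∂μ :=
        (lintegral_indicator_const hmissed _).symm
    _ ≤ expectedDisp n d := lintegral_mono hdisp

/-! ### Symmetrization -/

section Symmetrization

variable {S κ ι : Type*} [Fintype ι]

/-- The subsets of the index set that the members of the family `B` cut out of the points `z`; the
largest possible number of them is the growth function of the family. -/
noncomputable def patterns (B : κ → Set S) (z : ι → S) : Finset (Finset ι) :=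
  open scoped Classical in
  Finset.univ.filter fun I => ∃ k, ∀ p, p ∈ I ↔ z p ∈ B k

theorem mem_patterns {B : κ → Set S} {z : ι → S} {I : Finset ι} :
    I ∈ patterns B z ↔ ∃ k, ∀ p, p ∈ I ↔ z p ∈ B k := by
  simp only [patterns, Finset.mem_filter, Finset.mem_univ, true_and]

/-- The proportion of the points `Y` that lie in `A`. -/
noncomputable def empiricalFrequency (A : Set S) (Y : ι → S) : ℝ≥0∞ :=
  open scoped Classical in
  (Finset.univ.filter fun i => Y i ∈ A).card / Fintype.card ι

theorem empiricalFrequency_eq_sum (A : Set S) (Y : ι → S) :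
    empiricalFrequency A Y = (∑ i, A.indicator 1 (Y i)) * (Fintype.card ι : ℝ≥0∞)⁻¹ := by
  classical
  simp only [empiricalFrequency, Set.indicator_apply, Pi.one_apply, Finset.sum_boole,
    div_eq_mul_inv]

theorem empiricalFrequency_le_one (A : Set S) (Y : ι → S) : empiricalFrequency A Y ≤ 1 := by
  refine ENNReal.div_le_of_le_mul ?_
  rw [one_mul]
  exact_mod_cast Finset.card_le_univ _

theorem empiricalFrequency_le_of_forall {A A' : Set S} {Y : ι → S}
    (h : ∀ i, Y i ∈ A → Y i ∈ A') : empiricalFrequency A Y ≤ empiricalFrequency A' Y := by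
  classical
  exact ENNReal.div_le_div_right (Nat.cast_le.2 (Finset.card_le_card
    (Finset.monotone_filter_right _ fun i _ => h i))) _

/-- The largest proportion of the points of the second half of the sample `w` in a member of the
family `B` that contains no point of the first half. -/
noncomputable def emptyFrequency (B : κ → Set S) (w : ι ⊕ ι → S) : ℝ≥0∞ :=
  ⨆ (k) (_ : ∀ i, w (Sum.inl i) ∉ B k), empiricalFrequency (B k) (w ∘ Sum.inr)

/-- The splitting of the pairs `{(i, false), (i, true)}` into two halves in which the choices `σ`
determine the first half. -/
def choiceEquiv (σ : ι → Bool) : ι ⊕ ι ≃ ι × Bool where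
  toFun := Sum.elim (fun i => (i, σ i)) fun i => (i, !σ i)
  invFun p := bif xor (σ p.1) p.2 then Sum.inr p.1 else Sum.inl p.1
  left_inv := by rintro (i | i) <;> simp
  right_inv := by rintro ⟨i, b⟩; cases h : σ i <;> cases b <;> simp [h]

theorem card_filter_forall_notMem_mul_two_pow_le [DecidableEq ι] (I : Finset (ι × Bool)) :
    (Finset.univ.filter fun σ : ι → Bool => ∀ i, (i, σ i) ∉ I).card * 2 ^ I.card ≤
      2 ^ Fintype.card ι := by
  set fiber : ι → Finset Bool := fun i => Finset.univ.filter fun b => (i, b) ∈ I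
  have hchoices : (Finset.univ.filter fun σ : ι → Bool => ∀ i, (i, σ i) ∉ I) =
      Fintype.piFinset fun i => Finset.univ.filter fun b => b ∉ fiber i := by
    ext σ
    simp [fiber, Fintype.mem_piFinset]
  have hI : I.card = ∑ i, (fiber i).card := by
    simp only [fiber, Finset.card_filter]
    rw [← Fintype.sum_prod_type fun p => if p ∈ I then 1 else 0, Finset.sum_boole,
      Finset.filter_univ_mem, Nat.cast_id]
  have hbool : ∀ J : Finset Bool,
      (Finset.univ.filter fun b => b ∉ J).card * 2 ^ J.card ≤ 2 := by decide
  rw [hchoices, Fintype.card_piFinset, hI, ← Finset.prod_pow_eq_pow_sum,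
    ← Finset.prod_mul_distrib]
  exact (Finset.prod_le_prod' fun i _ => hbool (fiber i)).trans_eq
    (by rw [Finset.prod_const, Finset.card_univ])

theorem emptyFrequency_comp_choiceEquiv_le [DecidableEq ι] (B : κ → Set S) (z : ι × Bool → S)
    (m : ℕ) (σ : ι → Bool) :
    emptyFrequency B (z ∘ choiceEquiv σ) ≤ (m : ℝ≥0∞) / Fintype.card ι +
      (((patterns B z).filter (m < ·.card)).filter fun I => ∀ i, (i, σ i) ∉ I).card := by
  classical
  refine iSup₂_le fun k hk => ?_
  set I : Finset (ι × Bool) := Finset.univ.filter fun p => z p ∈ B k with hI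
  have hmem (p : ι × Bool) : p ∈ I ↔ z p ∈ B k := by
    rw [hI, Finset.mem_filter_univ]
  have hcount : (Finset.univ.filter fun i => z (i, !σ i) ∈ B k).card ≤ I.card :=
    Finset.card_le_card_of_injOn (fun i => (i, !σ i))
      (fun i hi => (hmem _).2 (Finset.mem_filter.1 hi).2)
      fun i _ j _ hij => congrArg Prod.fst hij
  rcases le_or_gt I.card m with hIm | hIm
  · exact le_add_right (ENNReal.div_le_div_right (by exact_mod_cast hcount.trans hIm) _)
  · refine le_add_left ((empiricalFrequency_le_one _ _).trans ?_)
    have hne : I ∈ ((patterns B z).filter (m < ·.card)).filter fun I => ∀ i, (i, σ i) ∉ I :=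
      Finset.mem_filter.2 ⟨Finset.mem_filter.2 ⟨mem_patterns.2 ⟨k, hmem⟩, hIm⟩,
        fun i hi => hk i ((hmem _).1 hi)⟩
    exact_mod_cast Finset.card_pos.2 ⟨I, hne⟩

theorem sum_emptyFrequency_le [DecidableEq ι] (B : κ → Set S) (z : ι × Bool → S) (m : ℕ) :
    ∑ σ : ι → Bool, emptyFrequency B (z ∘ choiceEquiv σ) ≤
      2 ^ Fintype.card ι *
        ((m : ℝ≥0∞) / Fintype.card ι + (patterns B z).card / 2 ^ m) := by
  set n := Fintype.card ι
  set T := (patterns B z).filter (m < ·.card)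
  have hpattern (I) (hI : I ∈ T) :
      ((Finset.univ.filter fun σ : ι → Bool => ∀ i, (i, σ i) ∉ I).card : ℝ≥0∞) ≤
        2 ^ n / 2 ^ m := by
    rw [ENNReal.le_div_iff_mul_le (by simp) (by simp)]
    have hpow : 2 ^ m ≤ 2 ^ I.card := Nat.pow_le_pow_right two_pos (Finset.mem_filter.1 hI).2.le
    exact_mod_cast (Nat.mul_le_mul_left _ hpow).trans (card_filter_forall_notMem_mul_two_pow_le I)
  have hdouble : ∑ σ : ι → Bool, (T.filter fun I => ∀ i, (i, σ i) ∉ I).card =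
      ∑ I ∈ T, (Finset.univ.filter fun σ : ι → Bool => ∀ i, (i, σ i) ∉ I).card := by
    simp only [Finset.card_filter]
    exact Finset.sum_comm
  calc ∑ σ : ι → Bool, emptyFrequency B (z ∘ choiceEquiv σ) ≤
        ∑ σ : ι → Bool,
          ((m : ℝ≥0∞) / n + (T.filter fun I => ∀ i, (i, σ i) ∉ I).card) :=
        Finset.sum_le_sum fun σ _ => emptyFrequency_comp_choiceEquiv_le B z m σ
    _ = 2 ^ n * ((m : ℝ≥0∞) / n) +
        ∑ I ∈ T, ((Finset.univ.filter fun σ : ι → Bool => ∀ i, (i, σ i) ∉ I).card : ℝ≥0∞) := by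
        rw [Finset.sum_add_distrib, ← Nat.cast_sum, hdouble, Nat.cast_sum, Finset.sum_const,
          Finset.card_univ, Fintype.card_fun, Fintype.card_bool, nsmul_eq_mul, Nat.cast_pow,
          Nat.cast_ofNat]
    _ ≤ 2 ^ n * ((m : ℝ≥0∞) / n) + (patterns B z).card * (2 ^ n / 2 ^ m) := by
        gcongr
        refine (Finset.sum_le_card_nsmul _ _ _ hpattern).trans ?_
        rw [nsmul_eq_mul]
        gcongr
        exact Finset.filter_subset _ _
    _ = 2 ^ n * ((m : ℝ≥0∞) / n + (patterns B z).card / 2 ^ m) := by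
        simp only [div_eq_mul_inv]
        ring

section Measure

variable [MeasurableSpace S]

theorem measurable_empiricalFrequency {A : Set S} (hA : MeasurableSet A) :
    Measurable fun Y : ι → S => empiricalFrequency A Y := by
  simp only [empiricalFrequency_eq_sum]
  exact (Finset.measurable_fun_sum _ fun i _ =>
    (measurable_one.indicator hA).comp (measurable_pi_apply i)).mul_const _

theorem lintegral_empiricalFrequency [Nonempty ι] (μ : Measure S) [IsProbabilityMeasure μ]
    {A : Set S} (hA : MeasurableSet A) :
    ∫⁻ Y : ι → S, empiricalFrequency A Y ∂(Measure.pi fun _ => μ) = μ A := by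
  have hmeas : Measurable (A.indicator (1 : S → ℝ≥0∞)) := measurable_one.indicator hA
  have hmeas_coord (i : ι) : Measurable fun Y : ι → S => A.indicator (1 : S → ℝ≥0∞) (Y i) :=
    hmeas.comp (measurable_pi_apply i)
  have hcoord (i : ι) : ∫⁻ Y : ι → S, A.indicator 1 (Y i) ∂(Measure.pi fun _ => μ) = μ A := by
    rw [(measurePreserving_eval (fun _ : ι => μ) i).lintegral_comp hmeas,
      lintegral_indicator_one hA]
  simp only [empiricalFrequency_eq_sum]
  rw [lintegral_mul_const _ (Finset.measurable_fun_sum _ fun i _ => hmeas_coord i),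
    lintegral_finsetSum _ fun i _ => hmeas_coord i]
  simp only [hcoord, Finset.sum_const, Finset.card_univ, nsmul_eq_mul]
  rw [mul_right_comm, ENNReal.mul_inv_cancel (Nat.cast_ne_zero.2 Fintype.card_ne_zero)
    (ENNReal.natCast_ne_top _), one_mul]

theorem measurable_emptyFrequency [Countable κ] {B : κ → Set S} (hB : ∀ k, MeasurableSet (B k)) :
    Measurable (emptyFrequency (ι := ι) B) := by
  refine Measurable.iSup fun k => ?_
  have hempty : MeasurableSet {w : ι ⊕ ι → S | ∀ i, w (Sum.inl i) ∉ B k} := by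
    rw [Set.ofPred_forall]
    exact MeasurableSet.iInter fun i => (hB k).compl.preimage (measurable_pi_apply (Sum.inl i))
  have hfreq : Measurable fun w : ι ⊕ ι → S => empiricalFrequency (B k) (w ∘ Sum.inr) :=
    (measurable_empiricalFrequency (hB k)).comp
      (measurable_pi_lambda _ fun i => measurable_pi_apply _)
  convert hfreq.indicator hempty using 2 with w
  by_cases hw : ∀ i, w (Sum.inl i) ∉ B k
  · rw [iSup_pos hw, Set.indicator_of_mem (Set.mem_ofPred_eq ▸ hw)]
  · rw [iSup_neg hw, Set.indicator_of_notMem (Set.mem_ofPred_eq ▸ hw), bot_eq_zero]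

theorem lintegral_emptyFrequency_le [Countable κ] (μ : Measure S) [IsProbabilityMeasure μ]
    {B : κ → Set S} (hB : ∀ k, MeasurableSet (B k)) {K : ℕ}
    (hK : ∀ z : ι × Bool → S, (patterns B z).card ≤ K) (m : ℕ) :
    ∫⁻ w : ι ⊕ ι → S, emptyFrequency B w ∂(Measure.pi fun _ => μ) ≤
      (m : ℝ≥0∞) / Fintype.card ι + K / 2 ^ m := by
  classical
  set n := Fintype.card ι
  have hsplit (σ : ι → Bool) : MeasurePreserving (fun z : ι × Bool → S => z ∘ choiceEquiv σ)
      (Measure.pi fun _ => μ) (Measure.pi fun _ => μ) :=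
    (measurePreserving_piCongrLeft (fun _ : ι × Bool => μ) (choiceEquiv σ)).symm
  have hmeas := measurable_emptyFrequency (ι := ι) hB
  refine (ENNReal.mul_le_mul_iff_right (a := 2 ^ n) (by simp) (by simp)).1 ?_
  calc 2 ^ n * ∫⁻ w : ι ⊕ ι → S, emptyFrequency B w ∂(Measure.pi fun _ => μ) =
        ∑ σ : ι → Bool, ∫⁻ z, emptyFrequency B (z ∘ choiceEquiv σ) ∂(Measure.pi fun _ => μ) := by
        simp only [(hsplit _).lintegral_comp hmeas, Finset.sum_const, Finset.card_univ,
          Fintype.card_fun, Fintype.card_bool, nsmul_eq_mul, Nat.cast_pow, Nat.cast_ofNat, n]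
    _ = ∫⁻ z, ∑ σ : ι → Bool, emptyFrequency B (z ∘ choiceEquiv σ) ∂(Measure.pi fun _ => μ) :=
        (lintegral_finsetSum _ fun σ _ => hmeas.comp (hsplit σ).measurable).symm
    _ ≤ ∫⁻ _ : ι × Bool → S, 2 ^ n * ((m : ℝ≥0∞) / n + K / 2 ^ m) ∂(Measure.pi fun _ => μ) := by
        refine lintegral_mono fun z => (sum_emptyFrequency_le B z m).trans ?_
        gcongr
        exact hK z
    _ = 2 ^ n * ((m : ℝ≥0∞) / n + K / 2 ^ m) := by
        rw [lintegral_const, measure_univ, mul_one]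

end Measure

end Symmetrization

/-! ### Growth functions of half-spaces, caps and slices -/

section GrowthFunction

variable {S κ κ' ι : Type*} [Fintype ι]

theorem exists_forall_mem_iff_of_shatters [DecidableEq ι] {B : κ → Set S} {z : ι → S}
    {s t : Finset ι} (hs : (patterns B z).Shatters s) (hts : t ⊆ s) :
    ∃ k, ∀ i ∈ s, i ∈ t ↔ z i ∈ B k := by
  obtain ⟨I, hI, rfl⟩ := hs hts
  obtain ⟨k, hk⟩ := mem_patterns.1 hI
  exact ⟨k, fun i hi => by rw [Finset.mem_inter, and_iff_right hi, hk]⟩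

theorem card_patterns_inter_le (B : κ → Set S) (B' : κ' → Set S) (z : ι → S) :
    (patterns (fun k : κ × κ' => B k.1 ∩ B' k.2) z).card ≤
      (patterns B z).card * (patterns B' z).card := by
  classical
  refine (Finset.card_le_card (t := Finset.image₂ (· ∩ ·) (patterns B z) (patterns B' z))
    fun I hI => ?_).trans (Finset.card_image₂_le _ _ _)
  obtain ⟨k, hk⟩ := mem_patterns.1 hI
  refine Finset.mem_image₂.2 ⟨Finset.univ.filter fun i => z i ∈ B k.1,
    mem_patterns.2 ⟨k.1, by simp⟩, Finset.univ.filter fun i => z i ∈ B' k.2,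
    mem_patterns.2 ⟨k.2, by simp⟩, ?_⟩
  ext i
  simp [hk]

variable {E : Type*} [AddCommGroup E] [Module ℝ E] [FiniteDimensional ℝ E]

/-- The open half-space `{f > t}` given by the pair `(f, t)` of a linear form and a level. -/
def halfSpace (k : Module.Dual ℝ E × ℝ) : Set E :=
  {y | k.2 < k.1 y}

theorem card_le_finrank_add_one_of_shatters_halfSpace [DecidableEq ι] {z : ι → E} {s : Finset ι}
    (hs : (patterns halfSpace z).Shatters s) : s.card ≤ Module.finrank ℝ E + 1 := by
  by_contra! hcard
  have hdep : ¬ AffineIndependent ℝ fun i : s => z i := fun h => by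
    have hle := h.card_le_finrank_succ.trans
      (Nat.succ_le_succ (Submodule.finrank_le (vectorSpan ℝ (range fun i : s => z i))))
    rw [Fintype.card_coe] at hle
    exact hcard.not_ge hle
  -- No half-space separates the two parts of a Radon partition of the points indexed by `s`.
  obtain ⟨I, p, hpI, hpI'⟩ := Convex.radon_partition hdep
  classical
  obtain ⟨⟨f, t⟩, hf⟩ := exists_forall_mem_iff_of_shatters hs
    (t := s.filter fun i => ∃ h : i ∈ s, (⟨i, h⟩ : s) ∈ I) (Finset.filter_subset _ _)
  have hI (i : s) : i ∈ I ↔ t < f (z i) := by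
    simpa [halfSpace] using hf i i.2
  have hgt : convexHull ℝ ((fun i : s => z i) '' I) ⊆ {y | t < f y} :=
    convexHull_min (image_subset_iff.2 fun i hi => (hI i).1 hi)
      (convex_halfSpace_gt f.isLinear t)
  have hle : convexHull ℝ ((fun i : s => z i) '' Iᶜ) ⊆ {y | f y ≤ t} :=
    convexHull_min (image_subset_iff.2 fun i hi => not_lt.1 fun h => hi ((hI i).2 h))
      (convex_halfSpace_le f.isLinear t)
  exact (show t < f p from hgt hpI).not_ge (hle hpI')

theorem card_patterns_halfSpace_le (z : ι → E) :
    (patterns halfSpace z).card ≤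
      ∑ k ∈ Finset.Iic (Module.finrank ℝ E + 1), (Fintype.card ι).choose k := by
  classical
  calc (patterns halfSpace z).card ≤ (patterns halfSpace z).shatterer.card :=
        Finset.card_le_card_shatterer _
    _ ≤ ∑ k ∈ Finset.Iic (patterns halfSpace z).vcDim, (Fintype.card ι).choose k :=
        Finset.card_shatterer_le_sum_vcDim
    _ ≤ _ := Finset.sum_le_sum_of_subset (Finset.Iic_subset_Iic.2 (Finset.sup_le fun s hs =>
        card_le_finrank_add_one_of_shatters_halfSpace (Finset.mem_shatterer.1 hs)))

end GrowthFunction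

section CountableSlice

variable {d : ℕ}

/-- The caps whose centre belongs to a fixed countable dense subset of the sphere and whose level
is rational. -/
noncomputable def rationalCap (d : ℕ) (k : ℕ × ℚ) : Set (Sph d) :=
  haveI : Nonempty (Sph d) := (NormedSpace.sphere_nonempty.2 zero_le_one).to_subtype
  cap (TopologicalSpace.denseSeq (Sph d) k.1) k.2

/-- The intersections of two members of `rationalCap`. Every empty slice can be replaced by one of
these, which makes the relevant supremum a countable one and hence measurable. -/
noncomputable def rationalSlice (d : ℕ) (k : (ℕ × ℚ) × (ℕ × ℚ)) : Set (Sph d) :=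
  rationalCap d k.1 ∩ rationalCap d k.2

theorem measurableSet_cap (x : Sph d) (t : ℝ) : MeasurableSet (cap x t) :=
  (isOpen_lt continuous_const (continuous_const.inner continuous_subtype_val)).measurableSet

theorem measurableSet_of_mem_slices {B : Set (Sph d)} (hB : B ∈ slices d) : MeasurableSet B := by
  obtain ⟨x, y, t, -, s, -, rfl⟩ := hB
  exact (measurableSet_cap x t).inter (measurableSet_cap y s)

theorem measurableSet_rationalSlice (k : (ℕ × ℚ) × (ℕ × ℚ)) :
    MeasurableSet (rationalSlice d k) :=
  (measurableSet_cap _ _).inter (measurableSet_cap _ _)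

theorem card_patterns_rationalCap_le {ι : Type*} [Fintype ι] (z : ι → Sph d) :
    (patterns (rationalCap d) z).card ≤
      ∑ k ∈ Finset.Iic (d + 2), (Fintype.card ι).choose k := by
  have hsub : patterns (rationalCap d) z ⊆
      patterns halfSpace fun i => (z i : EuclideanSpace ℝ (Fin (d + 1))) := fun I hI => by
    obtain ⟨k, hk⟩ := mem_patterns.1 hI
    exact mem_patterns.2 ⟨(innerₗ _ _, k.2), hk⟩
  simpa only [finrank_euclideanSpace_fin] using
    (Finset.card_le_card hsub).trans (card_patterns_halfSpace_le _)

theorem card_patterns_rationalSlice_le {ι : Type*} [Fintype ι] (z : ι → Sph d) :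
    (patterns (rationalSlice d) z).card ≤
      (∑ k ∈ Finset.Iic (d + 2), (Fintype.card ι).choose k) ^ 2 := by
  rw [sq]
  exact (card_patterns_inter_le _ _ z).trans
    (Nat.mul_le_mul (card_patterns_rationalCap_le z) (card_patterns_rationalCap_le z))

theorem cap_subset_cap {x x' : Sph d} {s t : ℝ} (h : dist x x' ≤ s - t) :
    cap x' s ⊆ cap x t := by
  intro y hy
  have hs : s < ⟪(x' : EuclideanSpace ℝ (Fin (d + 1))), y⟫_ℝ := hy
  have hdiff := real_inner_le_norm ((x' : EuclideanSpace ℝ (Fin (d + 1))) - x) y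
  rw [norm_eq_of_mem_sphere y, mul_one, inner_sub_left, ← dist_eq_norm, ← Subtype.dist_eq,
    dist_comm] at hdiff
  change t < ⟪(x : EuclideanSpace ℝ (Fin (d + 1))), y⟫_ℝ
  linarith

theorem exists_rationalCap_between {x : Sph d} {t : ℝ} {F : Finset (Sph d)}
    (hF : ↑F ⊆ cap x t) : ∃ k, ↑F ⊆ rationalCap d k ∧ rationalCap d k ⊆ cap x t := by
  obtain ⟨r, hr, htr⟩ : ∃ r, (∀ y ∈ F, r < ⟪(x : EuclideanSpace ℝ (Fin (d + 1))), y⟫_ℝ) ∧ t < r :=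
    (((Filter.eventually_all_finset F).2 fun y hy => eventually_nhdsWithin_of_eventually_nhds
      (eventually_lt_nhds (hF hy))).and (eventually_mem_nhdsWithin (s := Ioi t))).exists
  obtain ⟨q, htq, hqr⟩ := exists_rat_btwn htr
  have hnear : ∀ᶠ x' : Sph d in nhds x,
      (∀ y ∈ F, (q : ℝ) < ⟪(x' : EuclideanSpace ℝ (Fin (d + 1))), y⟫_ℝ) ∧ dist x' x < q - t :=
    ((Filter.eventually_all_finset F).2 fun y hy =>
      (continuous_subtype_val.inner continuous_const).continuousAt.eventually_const_lt
        (hqr.trans (hr y hy))).and (ball_mem_nhds x (sub_pos.2 htq))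
  have : Nonempty (Sph d) := ⟨x⟩
  obtain ⟨i, hi, hdist⟩ := (TopologicalSpace.denseRange_denseSeq (Sph d)).mem_nhds hnear
  exact ⟨(i, q), hi, cap_subset_cap (by rw [dist_comm]; exact hdist.le)⟩

theorem exists_rationalSlice_between {B : Set (Sph d)} (hB : B ∈ slices d) {F : Finset (Sph d)}
    (hF : ↑F ⊆ B) : ∃ k, ↑F ⊆ rationalSlice d k ∧ rationalSlice d k ⊆ B := by
  obtain ⟨x, y, t, -, s, -, rfl⟩ := hB
  obtain ⟨k, hFk, hk⟩ := exists_rationalCap_between (hF.trans inter_subset_left)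
  obtain ⟨l, hFl, hl⟩ := exists_rationalCap_between (hF.trans inter_subset_right)
  exact ⟨(k, l), subset_inter hFk hFl, inter_subset_inter hk hl⟩

end CountableSlice

/-! ### Upper bound for the expected dispersion -/

section UpperBound

variable {n d : ℕ}

theorem disp_range_le_lintegral_emptyFrequency {ι : Type*} [Fintype ι] [Nonempty ι]
    (X : ι → Sph d) :
    disp (range X) ≤ ∫⁻ Y : ι → Sph d, emptyFrequency (rationalSlice d) (Sum.elim X Y)
      ∂(Measure.pi fun _ => sphereMeasure d) := by
  classical
  refine iSup₂_le fun B ⟨hB, hXB⟩ => ?_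
  rw [← lintegral_empiricalFrequency (ι := ι) (sphereMeasure d) (measurableSet_of_mem_slices hB)]
  refine lintegral_mono fun Y => ?_
  obtain ⟨k, hYk, hkB⟩ := exists_rationalSlice_between hB
    (F := (Finset.univ.image Y).filter (· ∈ B)) fun y hy => (Finset.mem_filter.1 hy).2
  have hempty (i : ι) : X i ∉ rationalSlice d k := fun hi =>
    disjoint_left.1 (disjoint_iff_inter_eq_empty.2 hXB) (mem_range_self i) (hkB hi)
  refine le_iSup₂_of_le k hempty (empiricalFrequency_le_of_forall fun i hi => ?_)
  exact hYk (Finset.mem_filter.2 ⟨Finset.mem_image_of_mem Y (Finset.mem_univ i), hi⟩)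

theorem expectedDisp_le (hn : n ≠ 0) (m : ℕ) :
    expectedDisp n d ≤ (m : ℝ≥0∞) / n +
      ((∑ k ∈ Finset.Iic (d + 2), (n * 2).choose k : ℕ) : ℝ≥0∞) ^ 2 / 2 ^ m := by
  have : Nonempty (Fin n) := ⟨⟨0, Nat.pos_of_ne_zero hn⟩⟩
  have hsplit := measurePreserving_sumPiEquivProdPi_symm
    fun _ : Fin n ⊕ Fin n => sphereMeasure d
  have hmeas := measurable_emptyFrequency (ι := Fin n) (measurableSet_rationalSlice (d := d))
  calc expectedDisp n d ≤ ∫⁻ X : Fin n → Sph d, ∫⁻ Y : Fin n → Sph d,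
        emptyFrequency (rationalSlice d) (Sum.elim X Y) ∂(Measure.pi fun _ => sphereMeasure d)
          ∂(Measure.pi fun _ => sphereMeasure d) :=
        lintegral_mono disp_range_le_lintegral_emptyFrequency
    _ = ∫⁻ w : Fin n ⊕ Fin n → Sph d, emptyFrequency (rationalSlice d) w
          ∂(Measure.pi fun _ => sphereMeasure d) :=
        (lintegral_prod _ (hmeas.comp hsplit.measurable).aemeasurable).symm.trans
          (hsplit.lintegral_comp hmeas)
    _ ≤ _ := by
        simpa only [Fintype.card_fin, Fintype.card_prod, Fintype.card_bool, Nat.cast_pow] using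
          lintegral_emptyFrequency_le (ι := Fin n) (sphereMeasure d) measurableSet_rationalSlice
            card_patterns_rationalSlice_le m

theorem sum_choose_mul_pow_le (N D : ℕ) {x : ℝ} (hx0 : 0 ≤ x) (hx1 : x ≤ 1) :
    (∑ k ∈ Finset.Iic D, N.choose k : ℕ) * x ^ D ≤ (1 + x) ^ N := by
  calc (∑ k ∈ Finset.Iic D, N.choose k : ℕ) * x ^ D
      ≤ ∑ k ∈ Finset.Iic D, N.choose k * x ^ k := by
        rw [Nat.cast_sum, Finset.sum_mul]
        refine Finset.sum_le_sum fun k hk => mul_le_mul_of_nonneg_left ?_ (Nat.cast_nonneg _)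
        exact pow_le_pow_of_le_one hx0 hx1 (Finset.mem_Iic.1 hk)
    _ ≤ ∑ k ∈ Finset.Iic D ∪ Finset.range (N + 1), N.choose k * x ^ k :=
        Finset.sum_le_sum_of_subset_of_nonneg Finset.subset_union_left
          fun _ _ _ => by positivity
    _ = ∑ k ∈ Finset.range (N + 1), N.choose k * x ^ k := by
        refine (Finset.sum_subset Finset.subset_union_right fun k _ hk => ?_).symm
        rw [Nat.choose_eq_zero_of_lt (by simpa using hk), Nat.cast_zero, zero_mul]
    _ = (1 + x) ^ N := by
        rw [add_comm 1 x, add_pow]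
        simp only [one_pow, mul_one, mul_comm]

theorem sum_choose_le_exp (N D : ℕ) {x : ℝ} (hx0 : 0 < x) (hx1 : x ≤ 1) :
    (∑ k ∈ Finset.Iic D, N.choose k : ℕ) ≤ Real.exp (N * x - D * Real.log x) := by
  rw [Real.exp_sub, Real.exp_nat_mul, Real.exp_nat_mul, Real.exp_log hx0,
    le_div_iff₀ (pow_pos hx0 D)]
  refine (sum_choose_mul_pow_le N D hx0.le hx1).trans ?_
  gcongr
  rw [add_comm]
  exact Real.add_one_le_exp x

theorem expectedDisp_le_div_add_exp (hn : n ≠ 0) (m : ℕ) {x : ℝ} (hx0 : 0 < x) (hx1 : x ≤ 1) :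
    expectedDisp n d ≤ ENNReal.ofReal
      (m / n + Real.exp (4 * n * x - 2 * (d + 2) * Real.log x - m * Real.log 2)) := by
  set K := ∑ k ∈ Finset.Iic (d + 2), (n * 2).choose k
  have hK : (K : ℝ) ^ 2 / 2 ^ m ≤
      Real.exp (4 * n * x - 2 * (d + 2) * Real.log x - m * Real.log 2) := by
    rw [Real.exp_sub, Real.exp_nat_mul _ m, Real.exp_log two_pos]
    gcongr
    calc (K : ℝ) ^ 2 ≤
          Real.exp ((n * 2 : ℕ) * x - (d + 2 : ℕ) * Real.log x) ^ 2 := by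
          gcongr
          exact sum_choose_le_exp _ _ hx0 hx1
      _ = Real.exp (4 * n * x - 2 * (d + 2) * Real.log x) := by
          rw [← Real.exp_nat_mul]
          congr 1
          push_cast
          ring
  have hn0 : (0 : ℝ) < n := Nat.cast_pos.2 (Nat.pos_of_ne_zero hn)
  calc expectedDisp n d ≤ (m : ℝ≥0∞) / n + (K : ℝ≥0∞) ^ 2 / 2 ^ m := expectedDisp_le hn m
    _ = ENNReal.ofReal ((m : ℝ) / n + (K : ℝ) ^ 2 / 2 ^ m) := by
        rw [ENNReal.ofReal_add (by positivity) (by positivity), ENNReal.ofReal_div_of_pos hn0,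
          ENNReal.ofReal_div_of_pos (by positivity), ENNReal.ofReal_pow (Nat.cast_nonneg _),
          ENNReal.ofReal_pow two_pos.le, ENNReal.ofReal_natCast, ENNReal.ofReal_natCast,
          ENNReal.ofReal_natCast, ENNReal.ofReal_ofNat]
    _ ≤ _ := ENNReal.ofReal_le_ofReal (by gcongr)

variable {ε : ℝ}

theorem one_le_log_div (hε0 : 0 < ε) (hε1 : ε ≤ 1) : 1 ≤ Real.log (96 / ε) := by
  rw [Real.le_log_iff_exp_le (by positivity), le_div_iff₀ hε0]
  nlinarith [Real.exp_one_lt_d9]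

theorem expectedDisp_le_ofReal (hd : 1 ≤ d) (hε0 : 0 < ε) (hε1 : ε ≤ 1)
    (hn : 48 * (d * Real.log (96 / ε)) ≤ n * ε) : expectedDisp n d ≤ ENNReal.ofReal ε := by
  set L := Real.log (96 / ε) with hL
  have hL1 : 1 ≤ L := one_le_log_div hε0 hε1
  have hLd : L ≤ d * L := le_mul_of_one_le_left (by linarith) (Nat.one_le_cast.2 hd)
  have hn0 : (0 : ℝ) < n := pos_of_mul_pos_left (by linarith) hε0.le
  set m := ⌊n * ε / 2⌋₊
  have hm : (m : ℝ) / n ≤ ε / 2 := by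
    rw [div_le_iff₀ hn0]
    linarith [Nat.floor_le (show 0 ≤ n * ε / 2 by positivity)]
  have hm_log : (n * ε / 2 - 1) * (1 / 2) ≤ m * Real.log 2 :=
    mul_le_mul (by linarith [Nat.lt_floor_add_one (n * ε / 2)])
      (by linarith [Real.log_two_gt_d9]) (by norm_num) (by positivity)
  have hlog : Real.log (ε / 96) = -L := by rw [hL, ← Real.log_inv, inv_div]
  have hexp : Real.exp (4 * n * (ε / 96) - 2 * (d + 2) * Real.log (ε / 96) - m * Real.log 2) ≤
      ε / 2 := by
    rw [← Real.le_log_iff_exp_le (by positivity)]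
    have hhalf : Real.log (ε / 96) ≤ Real.log (ε / 2) :=
      Real.log_le_log (by positivity) (by linarith)
    rw [hlog] at hhalf ⊢
    linarith
  exact (expectedDisp_le_div_add_exp (Nat.cast_pos.1 hn0).ne' m (by positivity)
    (by linarith : ε / 96 ≤ 1)).trans (ENNReal.ofReal_le_ofReal (by linarith))

theorem floor_mem_admissible (hd : 1 ≤ d) (hε0 : 0 < ε) (hε1 : ε ≤ 1) :
    ⌊96 * (d / ε) * Real.log (96 / ε)⌋₊ ∈ admissible ε d := by
  have hL1 : 1 ≤ Real.log (96 / ε) := one_le_log_div hε0 hε1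
  have hdL : 1 ≤ d * Real.log (96 / ε) :=
    one_le_mul_of_one_le_of_one_le (Nat.one_le_cast.2 hd) hL1
  have hT : 96 * (d / ε) * Real.log (96 / ε) * ε = 96 * (d * Real.log (96 / ε)) := by field_simp
  have hfloor := Nat.lt_floor_add_one (96 * (d / ε) * Real.log (96 / ε))
  refine ⟨Nat.le_floor ?_, expectedDisp_le_ofReal hd hε0 hε1 (by nlinarith)⟩
  rw [Nat.cast_one]
  nlinarith

theorem isLeast_invExpectedDisp (hd : 1 ≤ d) (hε0 : 0 < ε) (hε1 : ε ≤ 1) :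
    IsLeast (admissible ε d) (invExpectedDisp ε d) :=
  ⟨Nat.sInf_mem ⟨_, floor_mem_admissible hd hε0 hε1⟩, fun _ hn => Nat.sInf_le hn⟩

theorem invExpectedDisp_le (hd : 1 ≤ d) (hε0 : 0 < ε) (hε1 : ε ≤ 1) :
    (invExpectedDisp ε d : ℝ) ≤ 96 * (d / ε) * Real.log (96 / ε) := by
  have hlog := one_le_log_div hε0 hε1
  exact (Nat.cast_le.2 (Nat.sInf_le (floor_mem_admissible hd hε0 hε1))).trans
    (Nat.floor_le (by positivity))

end UpperBound

/-! ### Lower bounds for the inverse of the expected dispersion -/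

section Inverse

variable {n d : ℕ} {ε : ℝ}

theorem one_div_le_of_mem_admissible (hε0 : 0 < ε) (hn : n ∈ admissible ε d) {N : ℕ} (hN : 0 < N)
    (h : ∀ P : Finset (Sph d), P.card ≤ n → (N : ℝ≥0∞)⁻¹ ≤ disp (P : Set (Sph d))) :
    1 / ε ≤ N := by
  have hN0 : (0 : ℝ) < N := Nat.cast_pos.2 hN
  have hle := (le_expectedDisp h).trans hn.2
  rw [← ENNReal.ofReal_natCast, ← ENNReal.ofReal_inv_of_pos hN0,
    ENNReal.ofReal_le_ofReal_iff hε0.le] at hle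
  rw [one_div]
  exact inv_le_of_inv_le₀ hN0 hle

theorem lt_of_mem_admissible (hd : 1 ≤ d) (hε0 : 0 < ε) (hε : ε < 1 / 2)
    (hn : n ∈ admissible ε d) : d < n := by
  by_contra! hnd
  have hle := one_div_le_of_mem_admissible (N := 2) hε0 hn two_pos
    fun P hP => inv_le_disp hd le_rfl (by omega)
  rw [div_le_iff₀ hε0, Nat.cast_ofNat] at hle
  linarith

theorem one_div_add_le_of_mem_admissible (hd : 1 ≤ d) (hε0 : 0 < ε) (hε : ε < 1 / 2)
    (hn : n ∈ admissible ε d) : 1 / ε + d - 2 ≤ n := by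
  have hdn := lt_of_mem_admissible hd hε0 hε hn
  have hle := one_div_le_of_mem_admissible (N := n + 2 - d) hε0 hn (by omega)
    fun P hP => inv_le_disp hd (by omega) (by omega)
  rw [Nat.cast_sub (by omega), Nat.cast_add, Nat.cast_ofNat] at hle
  linarith

theorem three_mul_lt_of_mem_admissible (hε0 : 0 < ε) (hε : ε < 1 / 4)
    (hn : n ∈ admissible ε d) : 3 * d < n + 2 := by
  by_contra! h
  have hle := one_div_le_of_mem_admissible (N := 4) hε0 hn four_pos
    fun P hP => quarter_le_disp (by omega)
  rw [div_le_iff₀ hε0, Nat.cast_ofNat] at hle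
  linarith

theorem one_div_two_mul_add_le_of_mem_admissible (hd : 1 ≤ d) (hε0 : 0 < ε) (hε : ε < 1 / 4)
    (hn : n ∈ admissible ε d) : 1 / (2 * ε) + 2 * d - 2 ≤ n := by
  -- This bound is the average of `1 / ε + d - 2` and `3 * d - 2`.
  have hquarter : (3 * d : ℝ) < n + 2 := by
    exact_mod_cast three_mul_lt_of_mem_admissible hε0 hε hn
  have hhalf := one_div_add_le_of_mem_admissible hd hε0 (by linarith) hn
  have h2 : 1 / (2 * ε) = 1 / ε / 2 := by field_simp
  linarith

theorem one_le_ceil_add_one_mul_pow {M : ℝ} (hM : 1 ≤ M) (hn : n ≤ M * Real.log M) :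
    1 ≤ ((⌈M⌉₊ + 1 : ℕ) : ℝ) * (1 - ((⌈M⌉₊ + 1 : ℕ) : ℝ)⁻¹) ^ n := by
  set k := ⌈M⌉₊
  have hMk : M ≤ k := Nat.le_ceil M
  have hk0 : (0 : ℝ) < k := by linarith
  have hlog : 0 ≤ Real.log M := Real.log_nonneg hM
  have hbase : 1 - ((k + 1 : ℕ) : ℝ)⁻¹ = (1 + 1 / (k : ℝ))⁻¹ := by
    push_cast
    field_simp
    ring
  have hpow : (1 + 1 / (k : ℝ)) ^ n ≤ M := by
    calc (1 + 1 / (k : ℝ)) ^ n ≤ Real.exp (1 / k) ^ n := by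
          gcongr
          rw [add_comm]
          exact Real.add_one_le_exp _
      _ = Real.exp (n / k) := by rw [← Real.exp_nat_mul, mul_one_div]
      _ ≤ Real.exp (Real.log M) := by
          gcongr
          rw [div_le_iff₀ hk0, mul_comm]
          exact hn.trans (by gcongr)
      _ = M := Real.exp_log (by linarith)
  rw [hbase, inv_pow, ← div_eq_mul_inv, le_div_iff₀ (by positivity), one_mul]
  push_cast
  linarith

theorem mul_log_le_of_mem_admissible (hd : 1 ≤ d) (hε0 : 0 < ε) (hn : n ∈ admissible ε d) :
    1 / (9 * ε) * Real.log (1 / (9 * ε)) ≤ n := by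
  set M := 1 / (9 * ε) with hM
  have hM0 : 0 < M := by positivity
  rcases le_total M 1 with hM1 | hM1
  · exact (mul_nonpos_of_nonneg_of_nonpos hM0.le (Real.log_nonpos hM0.le hM1)).trans
      (Nat.cast_nonneg n)
  by_contra! hlt
  have hle := (one_div_two_mul_le_expectedDisp hd
    (Nat.succ_le_succ (Nat.one_le_ceil_iff.2 hM0))
    (one_le_ceil_add_one_mul_pow hM1 hlt.le)).trans hn.2
  rw [ENNReal.ofReal_le_ofReal_iff hε0.le, div_le_iff₀ (by positivity)] at hle
  have hMε : M * (9 * ε) = 1 := by rw [hM]; field_simp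
  have hceil := Nat.ceil_lt_add_one hM0.le
  push_cast at hle
  nlinarith

end Inverse

/-! ### Asymptotic orders -/

section Asymptotic

open Asymptotics Filter

theorem log_le_two_mul_log {a b : ℝ} (ha : 0 < a) (hab : a ≤ b ^ 2) :
    Real.log a ≤ 2 * Real.log b := by
  rw [← Nat.cast_two, ← Real.log_pow]
  exact Real.log_le_log ha hab

theorem one_div_mul_log_nonneg {ε : ℝ} (hε0 : 0 < ε) (hε1 : ε ≤ 1) :
    0 ≤ 1 / ε * Real.log (1 / ε) :=
  mul_nonneg (one_div_pos.2 hε0).le (Real.log_nonneg ((one_le_div hε0).2 hε1))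

variable {d : ℕ}

theorem invExpectedDisp_isBigO_nhdsWithin_zero (hd : 1 ≤ d) :
    (fun ε : ℝ => (invExpectedDisp ε d : ℝ)) =O[nhdsWithin 0 (Ioi 0)]
      fun ε => 1 / ε * Real.log (1 / ε) := by
  refine IsBigO.of_bound (96 * d * 2) ?_
  filter_upwards [Ioo_mem_nhdsGT (show (0 : ℝ) < 1 / 96 by norm_num)] with ε ⟨hε0, hε⟩
  have hlog : Real.log (96 / ε) ≤ 2 * Real.log (1 / ε) := log_le_two_mul_log (by positivity) (by
    rw [div_pow, one_pow, div_le_div_iff₀ hε0 (by positivity)]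
    nlinarith)
  rw [Real.norm_natCast, Real.norm_of_nonneg (one_div_mul_log_nonneg hε0 (by linarith))]
  calc (invExpectedDisp ε d : ℝ) ≤ 96 * (d / ε) * Real.log (96 / ε) :=
        invExpectedDisp_le hd hε0 (by linarith)
    _ ≤ 96 * (d / ε) * (2 * Real.log (1 / ε)) := by gcongr
    _ = 96 * d * 2 * (1 / ε * Real.log (1 / ε)) := by ring

theorem isBigO_invExpectedDisp_nhdsWithin_zero (hd : 1 ≤ d) :
    (fun ε : ℝ => 1 / ε * Real.log (1 / ε)) =O[nhdsWithin 0 (Ioi 0)]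
      fun ε => (invExpectedDisp ε d : ℝ) := by
  refine IsBigO.of_bound 18 ?_
  filter_upwards [Ioo_mem_nhdsGT (show (0 : ℝ) < 1 / 96 by norm_num)] with ε ⟨hε0, hε⟩
  have hlog : Real.log (1 / ε) ≤ 2 * Real.log (1 / (9 * ε)) :=
    log_le_two_mul_log (by positivity) (by
      rw [div_pow, one_pow, div_le_div_iff₀ hε0 (by positivity)]
      nlinarith)
  rw [Real.norm_natCast, Real.norm_of_nonneg (one_div_mul_log_nonneg hε0 (by linarith))]
  calc 1 / ε * Real.log (1 / ε) ≤ 1 / ε * (2 * Real.log (1 / (9 * ε))) := by gcongr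
    _ = 18 * (1 / (9 * ε) * Real.log (1 / (9 * ε))) := by field_simp; ring
    _ ≤ 18 * invExpectedDisp ε d := by
        gcongr
        exact mul_log_le_of_mem_admissible hd hε0
          (isLeast_invExpectedDisp hd hε0 (by linarith)).1

theorem invExpectedDisp_isTheta_atTop {ε : ℝ} (hε0 : 0 < ε) (hε : ε < 1 / 2) :
    (fun d : ℕ => (invExpectedDisp ε d : ℝ)) =Θ[atTop] fun d : ℕ => (d : ℝ) := by
  constructor
  · refine IsBigO.of_bound (96 / ε * Real.log (96 / ε)) ?_
    filter_upwards [eventually_ge_atTop 1] with d hd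
    rw [Real.norm_natCast, Real.norm_natCast]
    calc (invExpectedDisp ε d : ℝ) ≤ 96 * (d / ε) * Real.log (96 / ε) :=
          invExpectedDisp_le hd hε0 (by linarith)
      _ = 96 / ε * Real.log (96 / ε) * d := by ring
  · refine IsBigO.of_bound 1 ?_
    filter_upwards [eventually_ge_atTop 1] with d hd
    rw [Real.norm_natCast, Real.norm_natCast, one_mul]
    exact_mod_cast (lt_of_mem_admissible hd hε0 hε
      (isLeast_invExpectedDisp hd hε0 (by linarith)).1).le

end Asymptotic

end SphericalDispersion

theorem mainTheorem6_general :
    (∀ d : ℕ, 1 ≤ d → ∀ ε : ℝ, 0 < ε → ε < 1 / 4 →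
      IsLeast (SphericalDispersion.admissible ε d) (SphericalDispersion.invExpectedDisp ε d) ∧
      max (max (1 / ε + d - 2) (1 / (2 * ε) + 2 * d - 2))
          (1 / (9 * ε) * Real.log (1 / (9 * ε)))
        ≤ (SphericalDispersion.invExpectedDisp ε d : ℝ) ∧
      (SphericalDispersion.invExpectedDisp ε d : ℝ) ≤ 96 * (d / ε) * Real.log (96 / ε)) ∧
    (∀ d : ℕ, 1 ≤ d →
      Asymptotics.IsTheta (nhdsWithin (0 : ℝ) (Set.Ioi 0))
        (fun ε : ℝ => (SphericalDispersion.invExpectedDisp ε d : ℝ))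
        (fun ε : ℝ => 1 / ε * Real.log (1 / ε))) ∧
    (∀ ε : ℝ, 0 < ε → ε < 1 / 2 →
      Asymptotics.IsTheta Filter.atTop
        (fun d : ℕ => (SphericalDispersion.invExpectedDisp ε d : ℝ))
        (fun d : ℕ => (d : ℝ))) := by
  refine ⟨fun d hd ε hε0 hε => ?_, fun d hd =>
      ⟨SphericalDispersion.invExpectedDisp_isBigO_nhdsWithin_zero hd,
        SphericalDispersion.isBigO_invExpectedDisp_nhdsWithin_zero hd⟩,
    fun ε hε0 hε => SphericalDispersion.invExpectedDisp_isTheta_atTop hε0 hε⟩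
  have hleast := SphericalDispersion.isLeast_invExpectedDisp hd hε0 (by linarith)
  refine ⟨hleast, max_le (max_le ?_ ?_) ?_,
    SphericalDispersion.invExpectedDisp_le hd hε0 (by linarith)⟩
  · exact SphericalDispersion.one_div_add_le_of_mem_admissible hd hε0 (by linarith) hleast.1
  · exact SphericalDispersion.one_div_two_mul_add_le_of_mem_admissible hd hε0 hε hleast.1
  · exact SphericalDispersion.mul_log_le_of_mem_admissible hd hε0 hleast.1

theorem mainTheorem6 :
    (∀ d : ℕ, 1 ≤ d → ∀ ε : ℝ, 0 < ε → ε < 1 / (9 * Real.exp 1) →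
      -- the minimum defining `Ñ(ε,d)` exists
      IsLeast (SphericalDispersion.admissible ε d) (SphericalDispersion.invExpectedDisp ε d) ∧
      max (max (1 / ε + d - 2) (1 / (2 * ε) + 2 * d - 2))
          (1 / (9 * ε) * Real.log (1 / (9 * ε)))
        ≤ (SphericalDispersion.invExpectedDisp ε d : ℝ) ∧
      (SphericalDispersion.invExpectedDisp ε d : ℝ) ≤ 96 * (d / ε) * Real.log (96 / ε)) ∧
    -- exact order in `ε`, for fixed `d`
    (∀ d : ℕ, 1 ≤ d →
      Asymptotics.IsTheta (nhdsWithin (0 : ℝ) (Set.Ioi 0))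
        (fun ε : ℝ => (SphericalDispersion.invExpectedDisp ε d : ℝ))
        (fun ε : ℝ => 1 / ε * Real.log (1 / ε))) ∧
    -- exact order in `d`, for fixed `ε`
    (∀ ε : ℝ, 0 < ε → ε < 1 / (9 * Real.exp 1) →
      Asymptotics.IsTheta Filter.atTop
        (fun d : ℕ => (SphericalDispersion.invExpectedDisp ε d : ℝ))
        (fun d : ℕ => (d : ℝ))) := by
  have hexp : 1 / (9 * Real.exp 1) < 1 / 4 :=
    one_div_lt_one_div_of_lt four_pos (by linarith [Real.exp_one_gt_d9])
  obtain ⟨hbounds, hε_order, hd_order⟩ := mainTheorem6_general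
  exact ⟨fun d hd ε hε0 hε => hbounds d hd ε hε0 (hε.trans hexp), hε_order,
    fun ε hε0 hε => hd_order ε hε0 (by linarith)⟩
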